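/- Let $\kappa\in(0,\infty)\setminus\mathbb{Q}$ and write, for $x\in\mathbb{C}$, \[ h(x) = \frac{x\,\bigl(2(x+2)-\kappa\bigr)}{2\kappa}. \] For a non-negative integer $\lambda$ define the selection polynomial in $h_{\mathrm{in}}, h_{\mathrm{out}}$ by \[ P_\lambda(h_{\mathrm{in}},h_{\mathrm{out}}) = \sum_{k=1}^{\lambda+1}\ \sum_{\substack{p_1,\dots,p_k\ge 1\\ p_1+\cdots+p_k=\lambda+1}} \frac{(-4/\kappa)^{\lambda+1-k}\,(\lambda!)^2}{\prod_{u=1}^{k-1}\bigl(\sum_{i=1}^{u}p_i\bigr)\bigl(\sum_{i=u+1}^{k}p_i\bigr)} \prod_{j=1}^{k}(-1)^{p_j}\Bigl(\sum_{i>j}p_i + h(\lambda)-h_{\mathrm{out}}+p_j\,h_{\mathrm{in}}\Bigr). \] Then for every non-negative integer $\lambda$, every $\mu\in\mathbb{Q}$ and every $h_{\mathrm{out}}\in\mathbb{C}$, \[ P_\lambda\bigl(h(\mu),h_{\mathrm{out}}\bigr)=\prod_{\ell=0}^{\lambda}\bigl(h_{\mathrm{out}}-h(\lambda+\mu-2\ell)\bigr).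 \] -/

import Mathlib

noncomputable section

/-- The first row conformal weight `h(x) = x (2 (x + 2) - κ) / (2 κ)`, a quadratic polynomial
in the label `x`. -/
def firstRowWeight (κ : ℝ) (x : ℂ) : ℂ :=
  x * (2 * (x + 2) - (κ : ℂ)) / (2 * (κ : ℂ))

/-- The coefficient of the composition `p = (p_1, …, p_k)` of `l + 1`:
`(-4/κ)^(l+1-k) (l!)^2 / ∏_{u=1}^{k-1} (p_1 + ⋯ + p_u) (p_{u+1} + ⋯ + p_k)`.
The block `p_i` is `p.blocksFun` at the index `i - 1`, since `Fin k` counts from zero. -/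
def selectionCoeff (κ : ℝ) (l : ℕ) (p : Composition (l + 1)) : ℂ :=
  (-4 / (κ : ℂ)) ^ (l + 1 - p.length) * (l.factorial : ℂ) ^ 2 /
    ∏ u ∈ Finset.Icc 1 (p.length - 1),
      ((∑ i : Fin p.length with i.val < u, (p.blocksFun i : ℂ)) *
        (∑ i : Fin p.length with u ≤ i.val, (p.blocksFun i : ℂ)))

/-- The selection polynomial `P_l(hIn, hOut)`: the sum over all `k` and all
`p_1, …, p_k ≥ 1` with `p_1 + ⋯ + p_k = l + 1`, i.e. over all compositions of `l + 1`, of the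
coefficient times `∏_j (-1)^{p_j} (∑_{i > j} p_i + h(l) - hOut + p_j hIn)`. -/
def selectionPoly (κ : ℝ) (l : ℕ) (hIn hOut : ℂ) : ℂ :=
  ∑ p : Composition (l + 1),
    selectionCoeff κ l p *
      ∏ j : Fin p.length,
        ((-1 : ℂ) ^ p.blocksFun j *
          ((∑ i : Fin p.length with j < i, (p.blocksFun i : ℂ)) + firstRowWeight κ (l : ℂ)
            - hOut + (p.blocksFun j : ℂ) * hIn))

end

/-! Every factor attached to a block of a composition depends only on the partial sums `a < s` at
its two ends, so the sum over compositions solves a linear recursion in the last partial sum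
(`Composition.sum_prod_sizeUpTo`). With `k = κ/4` and a rescaling by `k ^ s`, the recursion says
that a Fuchsian operator (`fuchsOp`) kills the generating function `G` below degree `l + 1`. There
the leading factor `s * (l + 1 - s)` vanishes, and the remaining coefficient, an obstruction, is the
selection polynomial up to normalisation.

Writing `G = (1 - X) ^ a * H`, with `a` an exponent at `X = 1`, turns the operator into a
hypergeometric one (`fuchsOp_oneSubPow_mul`). Its recursion has two terms, so its obstruction is a
product of quadratics in `s`; for `a = 1 + μ / 2` these are the required factors. -/

open PowerSeries in
theorem coeff_X_mul_mk_one_mul (G : PowerSeries ℂ) (s : ℕ) :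
    coeff s (X * mk (fun _ => (1 : ℂ)) * G) = ∑ i ∈ Finset.range s, coeff i G := by
  cases s with
  | zero => simp
  | succ s =>
    rw [mul_assoc, coeff_succ_X_mul, mul_comm, coeff_mul,
      Finset.Nat.sum_antidiagonal_eq_sum_range_succ_mk]
    simp

theorem PowerSeries.derivative_mk_one :
    PowerSeries.derivative ℂ (PowerSeries.mk fun _ => (1 : ℂ)) =
      (PowerSeries.mk fun _ => (1 : ℂ)) ^ 2 := by
  ext s
  rw [sq, PowerSeries.coeff_mul, PowerSeries.coeff_derivative]
  simp

/-- The expansion of `(1 - X) ^ a`. -/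
noncomputable def oneSubPow (a : ℂ) : PowerSeries ℂ :=
  PowerSeries.mk fun m => ∏ i ∈ Finset.range m, (((i : ℂ) - a) / ((i : ℂ) + 1))

open PowerSeries in
theorem derivative_oneSubPow (a : ℂ) :
    derivative ℂ (oneSubPow a) = -C a * mk (fun _ => (1 : ℂ)) * oneSubPow a := by
  have h : (1 - X) * derivative ℂ (oneSubPow a) = -C a * oneSubPow a := by
    ext s
    rw [sub_mul, one_mul, map_sub, neg_mul, map_neg, coeff_C_mul, coeff_derivative]
    cases s with
    | zero => simp [oneSubPow]
    | succ s =>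
      rw [coeff_succ_X_mul, coeff_derivative]
      simp only [oneSubPow, coeff_mk]
      rw [Finset.prod_range_succ]
      have : ((s + 1 : ℕ) : ℂ) + 1 ≠ 0 := by exact_mod_cast Nat.succ_ne_zero (s + 1)
      field_simp
      push_cast
      ring
  have hi : mk (fun _ => (1 : ℂ)) * (1 - X) = 1 := 
    mk_one_mul_one_sub_eq_one ℂ
  linear_combination mk (fun _ => (1 : ℂ)) * h - derivative ℂ (oneSubPow a) * hi

/-- The Fuchsian operator whose coefficients are the recursion for sums over compositions. -/
noncomputable def fuchsOp (N A B k : ℂ) (G : PowerSeries ℂ) : PowerSeries ℂ :=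
  let θ : PowerSeries ℂ → PowerSeries ℂ := fun F => .X * PowerSeries.derivative ℂ F
  let W : PowerSeries ℂ := .X * PowerSeries.mk fun _ => (1 : ℂ)
  .C N * θ G - θ (θ G) +
    .C k * (.C (N + A) * (W * G) + .C (B - 1) * (θ (W * G)) - .C B * (W * θ G))

/-- The hypergeometric operator to which `fuchsOp` is conjugate. -/
noncomputable def hyperOp (N b d : ℂ) (H : PowerSeries ℂ) : PowerSeries ℂ :=
  let θ : PowerSeries ℂ → PowerSeries ℂ := fun F => .X * PowerSeries.derivative ℂ F
  (1 - .X) * (.C N * θ H - θ (θ H)) + .X * (.C b * θ H + .C d * H)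

open PowerSeries in
theorem coeff_X_mul_derivative (G : PowerSeries ℂ) (s : ℕ) :
    coeff s (X * derivative ℂ G) = s * coeff s G := by
  cases s with
  | zero => simp
  | succ s => rw [coeff_succ_X_mul, coeff_derivative]; push_cast; ring

-- Multiplication by `X / (1 - X)` takes partial sums of coefficients, which produces the
-- full-history sum of the recursion.
open PowerSeries in
theorem coeff_fuchsOp (N A B k : ℂ) (G : PowerSeries ℂ) (s : ℕ) :
    coeff s (fuchsOp N A B k G) = s * (N - s) * coeff s G +
      k * ∑ i ∈ Finset.range s, (N - s + A + (s - i) * B) * coeff i G := by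
  simp only [fuchsOp, map_add (coeff s), map_sub (coeff s), coeff_C_mul, coeff_X_mul_derivative,
    coeff_X_mul_mk_one_mul]
  have : ∑ i ∈ Finset.range s, (N - s + A + (s - i) * B) * coeff i G =
      (N - s + A + s * B) * ∑ i ∈ Finset.range s, coeff i G -
        B * ∑ i ∈ Finset.range s, i * coeff i G := by
    rw [Finset.mul_sum, Finset.mul_sum, ← Finset.sum_sub_distrib]
    exact Finset.sum_congr rfl fun i _ => by ring
  rw [this]
  ring

open PowerSeries in
theorem coeff_hyperOp_succ (N b d : ℂ) (H : PowerSeries ℂ) (s : ℕ) :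
    coeff (s + 1) (hyperOp N b d H) = (s + 1) * (N - (s + 1)) * coeff (s + 1) H -
      (s * (N - s) - b * s - d) * coeff s H := by
  have h1 := coeff_X_mul_derivative H
  have h2 := coeff_X_mul_derivative (X * derivative ℂ H)
  simp only [hyperOp]
  generalize X * derivative ℂ (X * derivative ℂ H) = T at *
  generalize X * derivative ℂ H = U at *
  rw [sub_mul, one_mul]
  simp only [map_add (coeff _), map_sub (coeff _), coeff_C_mul, coeff_succ_X_mul, h2, h1]
  push_cast
  ring

-- The hypothesis is the indicial equation at `X = 1`: it cancels the pole that conjugation by `(1 -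
-- X) ^ a` would otherwise leave.
open PowerSeries in
theorem fuchsOp_oneSubPow_mul (N A B k a : ℂ) (h : a - a ^ 2 + k * (B - 1 + a) = 0)
    (H : PowerSeries ℂ) :
    (1 - X) * fuchsOp N A B k (oneSubPow a * H) =
      oneSubPow a * hyperOp N (2 * a - k) (a - N * a + k * (N + A + B - 1)) H := by
  have hi : mk (fun _ => (1 : ℂ)) * (1 - X) = 1 := 
    mk_one_mul_one_sub_eq_one ℂ
  have hC : C a - C a ^ 2 + C k * (C B - 1 + C a) = (0 : PowerSeries ℂ) := by
    have := congrArg (C (R := ℂ)) h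
    simpa using this
  simp only [fuchsOp, hyperOp, Derivation.leibniz, smul_eq_mul, derivative_oneSubPow, map_add,
    map_sub, map_mul, map_neg, map_one, derivative_X, PowerSeries.derivative_mk_one,
    derivative_C, map_ofNat]
  generalize derivative ℂ (derivative ℂ H) = H2
  generalize derivative ℂ H = H1
  generalize mk (fun _ => (1 : ℂ)) = i at *
  generalize oneSubPow a = E
  generalize (C a : PowerSeries ℂ) = a' at *
  generalize (C k : PowerSeries ℂ) = k' at *
  generalize (C N : PowerSeries ℂ) = N' at *
  generalize (C A : PowerSeries ℂ) = A' at *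
  generalize (C B : PowerSeries ℂ) = B' at *
  generalize (X : PowerSeries ℂ) = x at *
  clear h
  grind

/-- Removing the last block `m - a` leaves an arbitrary composition of some `a < m`. -/
theorem Composition.sum_prod_sizeUpTo {R : Type*} [CommRing R] (w : ℕ → ℕ → R) (S : ℕ → R) (n : ℕ)
    (h0 : S 0 = 1) (hS : ∀ m, 0 < m → m ≤ n → S m = ∑ a ∈ Finset.range m, w a m * S a)
    (m : ℕ) (hm : m ≤ n) :
    ∑ c : Composition m, ∏ u ∈ Finset.range c.length, w (c.sizeUpTo u) (c.sizeUpTo (u + 1)) =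
      S m := by
  induction m using Nat.strong_induction_on with
  | _ m ih =>
  rcases Nat.eq_zero_or_pos m with rfl | hpos
  · have : ∀ c : Composition 0, c.length = 0 := fun c => Nat.le_zero.1 c.length_le
    simp [this, h0, composition_card]
  rw [hS m hpos hm, Finset.sum_range]
  have : ∀ a : Fin m, w a m * S a = ∑ c : Composition a,
      w a m * ∏ u ∈ Finset.range c.length, w (c.sizeUpTo u) (c.sizeUpTo (u + 1)) := by
    intro a
    rw [← Finset.mul_sum, ih a a.2 (a.2.le.trans hm)]
  simp only [this]
  rw [← Fintype.sum_sigma', eq_comm]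
  refine Finset.sum_bij (fun x _ => (⟨x.2.blocks ++ [m - x.1], ?_, ?_⟩ : Composition m))
    (fun _ _ => Finset.mem_univ _) ?_ ?_ ?_
  · intro i hi
    rcases List.mem_append.1 hi with hi | hi
    · exact x.2.blocks_pos hi
    · rw [List.mem_singleton.1 hi]
      exact Nat.sub_pos_of_lt x.1.2
  · simp [x.1.2.le]
  · rintro ⟨a, c⟩ - ⟨b, d⟩ - h
    have h : c.blocks = d.blocks :=
      (List.append_inj' (congrArg Composition.blocks h) rfl).1
    have hab : a = b := Fin.ext (by rw [← c.blocks_sum, ← d.blocks_sum, h])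
    subst hab
    rw [Composition.ext h]
  · intro c _
    have hne : c.blocks ≠ [] := fun h => hpos.ne' (c.blocks_eq_nil.1 h)
    have hs : c.blocks.dropLast.sum + c.blocks.getLast hne = m := by
      conv_rhs => rw [← c.blocks_sum, ← List.dropLast_append_getLast hne]
      simp
    have hl : 0 < c.blocks.getLast hne := c.blocks_pos (List.getLast_mem hne)
    refine ⟨⟨⟨c.blocks.dropLast.sum, by omega⟩, ⟨c.blocks.dropLast, ?_, rfl⟩⟩,
      Finset.mem_univ _, ?_⟩
    · exact fun hi => c.blocks_pos (List.mem_of_mem_dropLast hi)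
    · apply Composition.ext
      simp only
      rw [show m - c.blocks.dropLast.sum = c.blocks.getLast hne by omega]
      exact List.dropLast_append_getLast hne
  · rintro ⟨a, c⟩ -
    simp only [Composition.length, Composition.sizeUpTo, List.length_append, List.length_singleton]
    rw [Finset.prod_range_succ, mul_comm]
    congr 1
    · refine Finset.prod_congr rfl fun u hu => ?_
      have hu := Finset.mem_range.1 hu
      rw [List.take_append_of_le_length hu.le, List.take_append_of_le_length hu]
    · have ha : (a : ℕ) + (m - a) = m := Nat.add_sub_cancel' a.2.le
      simp [List.take_append, List.take_of_length_le (Nat.le_succ c.blocks.length), c.blocks_sum, ha]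

/-! ### The truncated recursion and its obstruction -/

theorem prod_range_mul_sub_eq_factorial_sq (l : ℕ) :
    ∏ i ∈ Finset.range l, (((i : ℂ) + 1) * ((l : ℂ) + 1 - (i + 1))) = (l.factorial : ℂ) ^ 2 := by
  have h1 : ∏ i ∈ Finset.range l, ((i : ℂ) + 1) = l.factorial := by
    exact_mod_cast congrArg (Nat.cast (R := ℂ)) (Finset.prod_range_add_one_eq_factorial l)
  rw [Finset.prod_mul_distrib, sq, h1]
  congr 1
  rw [← h1, ← Finset.prod_range_reflect]
  refine Finset.prod_congr rfl fun i hi => ?_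
  have := Finset.mem_range.1 hi
  rw [Nat.sub_sub, Nat.cast_sub (by omega)]
  push_cast
  ring

open PowerSeries in
/-- A solution of the hypergeometric recursion, modulo its obstruction in degree `l + 1`. -/
theorem exists_hyperOp_solution (l : ℕ) (b d : ℂ) :
    ∃ H Q : PowerSeries ℂ, coeff 0 H = 1 ∧ hyperOp (l + 1) b d H = X ^ (l + 1) * Q ∧
      coeff 0 Q = -(∏ s ∈ Finset.range (l + 1), ((s : ℂ) * (l + 1 - s) - b * s - d)) /
        (l.factorial : ℂ) ^ 2 := by
  set c : ℕ → ℂ := fun s => (s : ℂ) * (l + 1 - s) - b * s - d with hc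
  set H : PowerSeries ℂ := mk fun s => if s < l + 1 then
    ∏ i ∈ Finset.range s, c i / (((i : ℂ) + 1) * ((l : ℂ) + 1 - (i + 1))) else 0 with hH
  have hdvd : X ^ (l + 1) ∣ hyperOp (l + 1) b d H := by
    rw [X_pow_dvd_iff]
    intro m hm
    cases m with
    | zero => simp [hyperOp]
    | succ s =>
      have h1 : (s : ℂ) + 1 ≠ 0 := Nat.cast_add_one_ne_zero s
      have h2 : (l : ℂ) + 1 - (s + 1) ≠ 0 := by
        rw [add_sub_add_right_eq_sub, sub_ne_zero]
        exact_mod_cast (by omega : l ≠ s)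
      rw [coeff_hyperOp_succ, hH, coeff_mk, coeff_mk, if_pos hm, if_pos (by omega),
        Finset.prod_range_succ]
      change _ - c s * _ = 0
      field_simp
      ring
  obtain ⟨Q, hQ⟩ := hdvd
  refine ⟨H, Q, by simp [hH], hQ, ?_⟩
  have h := congrArg (coeff (l + 1)) hQ
  rw [coeff_hyperOp_succ, show coeff (l + 1) (X ^ (l + 1) * Q) = coeff 0 Q by
    simpa using coeff_X_pow_mul Q (l + 1) 0] at h
  rw [← h, hH, coeff_mk, coeff_mk, if_neg (lt_irrefl _), if_pos (Nat.lt_succ_self l),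
    Finset.prod_div_distrib, prod_range_mul_sub_eq_factorial_sq, Finset.prod_range_succ]
  change _ - c l * _ = _
  ring

open PowerSeries in
theorem exists_fuchs_recursion (l : ℕ) (A B k a : ℂ) (h : a - a ^ 2 + k * (B - 1 + a) = 0) :
    ∃ G : ℕ → ℂ, G 0 = 1 ∧
      (∀ s < l + 1, (s : ℂ) * (l + 1 - s) * G s +
        k * ∑ i ∈ Finset.range s, ((l : ℂ) + 1 - s + A + (s - i) * B) * G i = 0) ∧
      k * ∑ i ∈ Finset.range (l + 1), (A + ((l : ℂ) + 1 - i) * B) * G i =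
        -(∏ s ∈ Finset.range (l + 1), ((s : ℂ) * (l + 1 - s) - (2 * a - k) * s -
          (k * (l + A + B) - l * a))) / (l.factorial : ℂ) ^ 2 := by
  obtain ⟨H, Q, hH, hQ, hQ0⟩ := exists_hyperOp_solution l (2 * a - k) (k * (l + A + B) - l * a)
  have hi : mk (fun _ => (1 : ℂ)) * (1 - X) = 1 := mk_one_mul_one_sub_eq_one ℂ
  -- `1 / (1 - X)` and `(1 - X) ^ a` have constant term 1, so the lowest coefficient, the
  -- obstruction, is that of `Q`.
  have key : fuchsOp (l + 1) A B k (oneSubPow a * H) =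
      X ^ (l + 1) * (mk (fun _ => (1 : ℂ)) * oneSubPow a * Q) := by
    have := fuchsOp_oneSubPow_mul (l + 1) A B k a h H
    rw [show a - ((l : ℂ) + 1) * a + k * (l + 1 + A + B - 1) = k * (l + A + B) - l * a by ring,
      hQ] at this
    linear_combination mk (fun _ => (1 : ℂ)) * this - fuchsOp (l + 1) A B k (oneSubPow a * H) * hi
  have hE : constantCoeff (oneSubPow a) = 1 := by
    rw [← coeff_zero_eq_constantCoeff_apply]
    simp [oneSubPow]
  refine ⟨fun s => coeff s (oneSubPow a * H), ?_, fun s hs => ?_, ?_⟩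
  · simpa [hE] using hH
  · rw [← coeff_fuchsOp, key]
    exact X_pow_dvd_iff.1 (Dvd.intro _ rfl) s hs
  · have h2 := congrArg (coeff (l + 1)) key
    rw [coeff_fuchsOp, show coeff (l + 1) (X ^ (l + 1) * (mk (fun _ => (1 : ℂ)) * oneSubPow a * Q))
      = coeff 0 Q by
        have h3 := coeff_X_pow_mul (mk (fun _ => (1 : ℂ)) * oneSubPow a * Q) (l + 1) 0
        rw [zero_add] at h3
        rw [h3]
        have h4 : constantCoeff (mk fun _ => (1 : ℂ)) = 1 := by
          rw [← coeff_zero_eq_constantCoeff_apply, coeff_mk]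
        simp [hE, h4], hQ0] at h2
    rw [← h2]
    push_cast
    simp

/-- The weight of a block from partial sum `a` to partial sum `s`. -/
noncomputable def blockWeight (l : ℕ) (t A B : ℂ) (a s : ℕ) : ℂ :=
  t ^ (s - a - 1) * ((-1) ^ (s - a) * ((l : ℂ) + 1 - s + A + ((s : ℂ) - a) * B)) *
    if s = l + 1 then 1 else ((s : ℂ) * (l + 1 - s))⁻¹

theorem sum_prod_blockWeight (l : ℕ) (A B k a : ℂ) (hk : k ≠ 0)
    (h : a - a ^ 2 + k * (B - 1 + a) = 0) :
    ∑ c : Composition (l + 1), ∏ u ∈ Finset.range c.length,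
        blockWeight l (-k⁻¹) A B (c.sizeUpTo u) (c.sizeUpTo (u + 1)) =
      k⁻¹ ^ (l + 1) * (∏ s ∈ Finset.range (l + 1), ((s : ℂ) * (l + 1 - s) - (2 * a - k) * s -
          (k * (l + A + B) - l * a))) / (l.factorial : ℂ) ^ 2 := by
  obtain ⟨G, hG0, hG, hGl⟩ := exists_fuchs_recursion l A B k a h
  set p := ∏ s ∈ Finset.range (l + 1), ((s : ℂ) * (l + 1 - s) - (2 * a - k) * s -
          (k * (l + A + B) - l * a))
  have hw : ∀ b s : ℕ, b < s → blockWeight l (-k⁻¹) A B b s * (k⁻¹ ^ b * G b) =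
      -k⁻¹ ^ s * (if s = l + 1 then 1 else ((s : ℂ) * (l + 1 - s))⁻¹) *
        (k * (((l : ℂ) + 1 - s + A + (s - b) * B) * G b)) := by
    intro b s hb
    obtain ⟨q, rfl⟩ := Nat.exists_eq_add_of_lt hb
    have e : (-1 : ℂ) ^ q * (-1) ^ q = 1 := by rw [← mul_pow]; simp
    rw [blockWeight, show b + q + 1 - b - 1 = q by omega, show b + q + 1 - b = q + 1 by omega,
      neg_pow, pow_succ (-1 : ℂ), pow_succ k⁻¹, pow_add]
    have e' : k⁻¹ * k = 1 := inv_mul_cancel₀ hk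
    generalize (if b + q + 1 = l + 1 then (1 : ℂ) else _) = z
    generalize ((l : ℂ) + 1 - _ + A + _) = y
    linear_combination (-(k⁻¹ ^ q * y * z * k⁻¹ ^ b * G b)) * e +
      (k⁻¹ ^ q * y * z * k⁻¹ ^ b * G b) * e'
  -- The value at `l + 1` is prescribed separately, since the recursion for `G` stops at degree `l`.
  rw [Composition.sum_prod_sizeUpTo (blockWeight l (-k⁻¹) A B)
    (fun s => if s = l + 1 then k⁻¹ ^ (l + 1) * p / (l.factorial : ℂ) ^ 2 else k⁻¹ ^ s * G s)
    (l + 1) (by simp [hG0]) ?_ (l + 1) le_rfl, if_pos rfl]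
  intro m hm hml
  have hsum : ∑ b ∈ Finset.range m, blockWeight l (-k⁻¹) A B b m *
      (if b = l + 1 then k⁻¹ ^ (l + 1) * p / (l.factorial : ℂ) ^ 2 else k⁻¹ ^ b * G b) =
      -k⁻¹ ^ m * (if m = l + 1 then 1 else ((m : ℂ) * (l + 1 - m))⁻¹) *
        (k * ∑ b ∈ Finset.range m, ((l : ℂ) + 1 - m + A + (m - b) * B) * G b) := by
    rw [Finset.mul_sum, Finset.mul_sum]
    refine Finset.sum_congr rfl fun b hb => ?_
    have hb := Finset.mem_range.1 hb
    rw [if_neg (by omega), hw b m hb]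
  rw [hsum]
  by_cases hm' : m = l + 1
  · subst hm'
    rw [if_pos rfl, if_pos rfl]
    push_cast
    simp only [sub_self, zero_add]
    rw [hGl]
    ring
  · rw [if_neg hm', if_neg hm']
    have h1 : (m : ℂ) ≠ 0 := by exact_mod_cast hm.ne'
    have h2 : (l : ℂ) + 1 - m ≠ 0 := by
      rw [sub_ne_zero]
      exact_mod_cast (Ne.symm hm')
    rw [eq_neg_of_add_eq_zero_right (hG m (by omega))]
    field_simp

/-! ### From selection polynomial to block weights -/

theorem Composition.sum_blocksFun_lt {n : ℕ} (c : Composition n) (u : ℕ) :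
    ∑ i : Fin c.length with i.val < u, c.blocksFun i = c.sizeUpTo u := by
  rw [Composition.sizeUpTo, ← c.ofFn_blocksFun, List.sum_take_ofFn]

theorem Composition.sum_blocksFun_ge {n : ℕ} (c : Composition n) (u : ℕ) :
    (∑ i : Fin c.length with u ≤ i.val, (c.blocksFun i : ℂ)) = (n : ℂ) - c.sizeUpTo u := by
  have h := Finset.sum_filter_add_sum_filter_not Finset.univ
    (fun i : Fin c.length => i.val < u) (fun i => (c.blocksFun i : ℂ))
  simp only [not_lt] at h
  rw [eq_sub_iff_add_eq', ← c.sum_blocksFun_lt u]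
  push_cast
  rw [h]
  exact_mod_cast congrArg (Nat.cast (R := ℂ)) c.sum_blocksFun

theorem selectionCoeff_mul_prod (κ : ℝ) (l : ℕ) (hIn hOut : ℂ) (p : Composition (l + 1)) :
    selectionCoeff κ l p * ∏ j : Fin p.length, ((-1 : ℂ) ^ p.blocksFun j *
        ((∑ i : Fin p.length with j < i, (p.blocksFun i : ℂ)) + firstRowWeight κ (l : ℂ)
          - hOut + (p.blocksFun j : ℂ) * hIn)) =
      (l.factorial : ℂ) ^ 2 * ∏ u ∈ Finset.range p.length,
        blockWeight l (-4 / (κ : ℂ)) (firstRowWeight κ (l : ℂ) - hOut) hIn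
          (p.sizeUpTo u) (p.sizeUpTo (u + 1)) := by
  simp only [blockWeight, Finset.prod_mul_distrib (s := Finset.range p.length)]
  have hsub : ∀ j : Fin p.length, p.sizeUpTo (j + 1) - p.sizeUpTo j = p.blocksFun j := by
    intro j
    rw [p.sizeUpTo_succ', Nat.add_sub_cancel_left]
  have e1 : ∏ u ∈ Finset.range p.length,
      (-4 / (κ : ℂ)) ^ (p.sizeUpTo (u + 1) - p.sizeUpTo u - 1) =
      (-4 / (κ : ℂ)) ^ (l + 1 - p.length) := by
    rw [Finset.prod_pow_eq_pow_sum, Finset.sum_range]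
    congr 1
    simp only [hsub]
    have h : ∑ j, p.blocksFun j = ∑ j, (p.blocksFun j - 1) + p.length := by
      rw [← Finset.sum_congr rfl fun j _ => Nat.sub_add_cancel (p.one_le_blocksFun j),
        Finset.sum_add_distrib]
      simp
    rw [p.sum_blocksFun] at h
    omega
  have e2 : (∏ u ∈ Finset.range p.length, (-1 : ℂ) ^ (p.sizeUpTo (u + 1) - p.sizeUpTo u)) *
      ∏ u ∈ Finset.range p.length, ((l : ℂ) + 1 - p.sizeUpTo (u + 1) +
        (firstRowWeight κ (l : ℂ) - hOut) +
        ((p.sizeUpTo (u + 1) : ℂ) - p.sizeUpTo u) * hIn) =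
      ∏ j : Fin p.length, ((-1 : ℂ) ^ p.blocksFun j *
        ((∑ i : Fin p.length with j < i, (p.blocksFun i : ℂ)) + firstRowWeight κ (l : ℂ)
          - hOut + (p.blocksFun j : ℂ) * hIn)) := by
    rw [← Finset.prod_mul_distrib, Finset.prod_range]
    refine Finset.prod_congr rfl fun j _ => ?_
    have hj := p.sum_blocksFun_ge (j + 1)
    simp only [Nat.succ_le_iff, Fin.val_fin_lt] at hj
    rw [hj, hsub, p.sizeUpTo_succ']
    push_cast
    ring
  -- Only the last block ends at `l + 1`; its factor 1 matches the range `u ≤ k - 1` of the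
  -- denominator.
  have e3 : ∏ u ∈ Finset.range p.length, (if p.sizeUpTo (u + 1) = l + 1 then (1 : ℂ) else
      ((p.sizeUpTo (u + 1) : ℂ) * (l + 1 - p.sizeUpTo (u + 1)))⁻¹) =
      (∏ u ∈ Finset.Icc 1 (p.length - 1),
      ((∑ i : Fin p.length with i.val < u, (p.blocksFun i : ℂ)) *
        (∑ i : Fin p.length with u ≤ i.val, (p.blocksFun i : ℂ))))⁻¹ := by
    obtain ⟨r, hr⟩ : ∃ r, p.length = r + 1 :=
      Nat.exists_eq_succ_of_ne_zero (p.length_pos_iff.2 (Nat.succ_pos l)).ne'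
    have hlast : p.sizeUpTo (r + 1) = l + 1 := hr ▸ p.sizeUpTo_length
    simp only [p.sum_blocksFun_ge, ← Nat.cast_sum, p.sum_blocksFun_lt]
    rw [hr, Finset.prod_range_succ, if_pos hlast, mul_one, ← Finset.prod_inv_distrib,
      Nat.add_sub_cancel, ← Finset.Ico_add_one_right_eq_Icc, Finset.prod_Ico_eq_prod_range,
      Nat.add_sub_cancel]
    refine Finset.prod_congr rfl fun u hu => ?_
    have hu := Finset.mem_range.1 hu
    have h1 := p.sizeUpTo_strict_mono (i := u + 1) (by omega)
    have h2 := p.sizeUpTo_le (u + 1 + 1)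
    rw [if_neg (by omega), add_comm 1 u]
    push_cast
    rfl
  rw [e1, e2, e3, selectionCoeff]
  ring

theorem mainTheorem5 (κ : ℝ) (hκ_pos : 0 < κ) (hκ_irr : Irrational κ)
    (l : ℕ) (μ : ℚ) (hOut : ℂ) :
    selectionPoly κ l (firstRowWeight κ (μ : ℂ)) hOut =
      ∏ m ∈ Finset.range (l + 1),
        (hOut - firstRowWeight κ ((l : ℂ) + (μ : ℂ) - 2 * (m : ℂ))) := by
  have hκ : (κ : ℂ) ≠ 0 := by exact_mod_cast hκ_pos.ne'
  have hf : (l.factorial : ℂ) ≠ 0 := by exact_mod_cast l.factorial_ne_zero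
  have hk : (κ : ℂ) / 4 ≠ 0 := div_ne_zero hκ (by norm_num)
  have ht : -4 / (κ : ℂ) = -((κ : ℂ) / 4)⁻¹ := by rw [inv_div, neg_div]
  simp only [selectionPoly, selectionCoeff_mul_prod]
  -- `1 + μ / 2` is a root of the indicial equation when `B = h(μ)`. The reflection pairs the factor
  -- at `s` with `ℓ = l - s`.
  rw [← Finset.mul_sum, ht, sum_prod_blockWeight l _ _ _ (1 + μ / 2) hk
    (by rw [firstRowWeight]; field_simp; ring), mul_div_cancel₀ _ (pow_ne_zero 2 hf),
    ← Finset.prod_range_reflect (fun m => hOut - firstRowWeight κ _)]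
  have hpow : ((κ : ℂ) / 4)⁻¹ ^ (l + 1) = ∏ _m ∈ Finset.range (l + 1), ((κ : ℂ) / 4)⁻¹ := by
    rw [Finset.prod_const, Finset.card_range]
  rw [hpow, ← Finset.prod_mul_distrib]
  refine Finset.prod_congr rfl fun m hm => ?_
  have := Finset.mem_range.1 hm
  rw [Nat.add_sub_cancel, Nat.cast_sub (by omega)]
  simp only [firstRowWeight]
  field_simp
  ring
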